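/- Consider the linear model $y=X\beta+\epsilon$ with $X\in\mathbb{R}^{n\times p}$ ($n\ge 1$, $p\ge 2$), where the rows of $X$ are i.i.d. $N_p(0,\Omega^{-1})$ and $\epsilon\sim N_n(0,\sigma^2\mathrm{I})$ is independent of $X$. Write $\theta=(\beta,\Omega,\sigma)$ for the parameter, $Z=(Z_1,\dots,Z_n)$ with $Z_i=(y_i,X_{i\cdot})\in\mathbb{R}^{p+1}$ for the observed data, and $\mathbb{P}_\theta,\mathbb{E}_\theta$ for probability and expectation under $\theta$. For fixed constants $M_1>1$ and $M_2>0$ and an integer $k\ge 0$ let $$\Theta(k)=\Big\{(\beta,\Omega,\sigma):\ \|\beta\|_0\le k,\ \tfrac1{M_1}\le\lambda_{\min}(\Omega)\le\lambda_{\max}(\Omega)\le M_1,\ 0<\sigma\le M_2\Big\},$$ where $\|\beta\|_0$ is the number of nonzero coordinates of $\beta$ and $\Omega$ ranges over symmetric $p\times p$ matrices. Let $\mathcal{I}_\alpha(\Theta(k),\sum\beta_i)$ be the set of all intervals $\mathrm{CI}=[l(Z),u(Z)]$ with measurable real endpoints such that $$\inf_{\theta\in\Theta(k)}\mathbb{P}_\theta\Big(l(Z)\le\sum_{i=1}^p\beta_i\le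 u(Z)\Big)\ge 1-\alpha ,$$ and let $L(\mathrm{CI})$ be the length of $\mathrm{CI}$, that is $u(Z)-l(Z)$ (and $0$ if the interval is empty). Let $0<\alpha<\frac12$, $c>0$, $0\le\gamma<\frac12$ and $0<\zeta_0<1$ be constants. Then there is a constant $c_1>0$, depending only on $\alpha,c,\gamma,\zeta_0,M_1,M_2$, such that for all integers $n\ge1$, $p\ge2$ and $k,k_1\ge0$ with $$k\le c\min\Big\{p^\gamma,\frac{n}{\log p}\Big\}\qquad\text{and}\qquad k_1\le(1-\zeta_0)k-1,$$ and for every $\theta^*=(\beta^*,\mathrm{I},\sigma)\in\Theta(k_1)$, $$\inf_{\mathrm{CI}\in\mathcal{I}_\alpha(\Theta(k),\sum\beta_i)}\mathbb{E}_{\theta^*}L(\mathrm{CI})\ \ge\ c_1\,k\,\sqrt{\frac{\log p}{n}}\;\sigma .$$ -/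

import Mathlib

open MeasureTheory ProbabilityTheory

namespace SparseCI

/-- A parameter `θ = (β, Ω, σ)` of the `p`-dimensional Gaussian-design linear model: the regression
vector, the precision matrix of the design rows, and the noise level. -/
structure Param (p : ℕ) where
  beta : Fin p → ℝ
  Omega : Matrix (Fin p) (Fin p) ℝ
  sigma : ℝ

/-- The parameter space `Θ(k)`: `‖β‖₀ ≤ k`, `Ω` symmetric with all its eigenvalues in `[1/M₁, M₁]`,
and `0 < σ ≤ M₂`. -/
def Theta (M₁ M₂ : ℝ) (p k : ℕ) : Set (Param p) :=
  {θ | hammingNorm θ.beta ≤ k ∧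
    (∃ h : θ.Omega.IsHermitian, ∀ i, 1 / M₁ ≤ h.eigenvalues i ∧ h.eigenvalues i ≤ M₁) ∧
    0 < θ.sigma ∧ θ.sigma ≤ M₂}

/-- One observation `Zᵢ = (yᵢ, Xᵢ)`. -/
abbrev Obs (p : ℕ) : Type := ℝ × EuclideanSpace ℝ (Fin p)

/-- The law of one observation `(y, x)` with `y = xᵀβ + ε`, where `x ∼ N_p(0, Ω⁻¹)` and
`ε ∼ N(0, σ²)` are independent. -/
noncomputable def obsLaw {p : ℕ} (θ : Param p) : Measure (Obs p) :=
  ((multivariateGaussian 0 θ.Omega⁻¹).prod (gaussianReal 0 (θ.sigma ^ 2).toNNReal)).map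
    fun w : EuclideanSpace ℝ (Fin p) × ℝ => (∑ j, w.1 j * θ.beta j + w.2, w.1)

/-- The law `ℙ_θ` of the data `Z = (Z₁, …, Zₙ)`: the observations are i.i.d. -/
noncomputable def dataLaw (n : ℕ) {p : ℕ} (θ : Param p) : Measure (Fin n → Obs p) :=
  Measure.pi fun _ => obsLaw θ

/-- A data-driven interval `[l(Z), u(Z)]` with measurable endpoints; it is empty where
`u(Z) < l(Z)`. -/
structure Interval (n p : ℕ) where
  lower : (Fin n → Obs p) → ℝ
  upper : (Fin n → Obs p) → ℝ
  measurable_lower : Measurable lower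
  measurable_upper : Measurable upper

/-- The set `𝓘_α(Θ, T)` of `(1 - α)`-level confidence intervals for `T(β)` over `Θ`. -/
def confidenceIntervals (n : ℕ) {p : ℕ} (α : ℝ) (Θ : Set (Param p)) (T : (Fin p → ℝ) → ℝ) :
    Set (Interval n p) :=
  {CI | ENNReal.ofReal (1 - α) ≤
    ⨅ θ ∈ Θ, dataLaw n θ {z | CI.lower z ≤ T θ.beta ∧ T θ.beta ≤ CI.upper z}}

/-- The expected length `𝔼_θ L(CI) ∈ [0, ∞]`, where `[l, u]` has length `u - l` (and `0` if it
is empty). -/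
noncomputable def expectedLength {n p : ℕ} (θ : Param p) (CI : Interval n p) : ENNReal :=
  ∫⁻ z, ENNReal.ofReal (CI.upper z - CI.lower z) ∂(dataLaw n θ)

end SparseCI

/-! Le Cam's two-point method with a mixture alternative. From the null `(β, I, σ)`, add a spike of
height `ρ = σ√r` at `m` coordinates, one drawn uniformly from each of `m` disjoint blocks of size
`B`. Every alternative shifts `∑ βᵢ` by the same `mρ`. If the mixture is within `t` of the null, an
interval covering under both contains both sums with null probability at least `1 - 2α - t`, so its
expected length is at least `(1 - 2α - t) m ρ` (`le_expectedLength_of_blockSpike`).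

Closeness is a χ² bound. The noise variance drops to `σ² - mρ²`, so `y - xᵀβ` keeps its marginal law
`N(0, σ²)`. Two alternatives agreeing in `N` blocks then have likelihood-ratio correlation exactly
`1/(1 - rN)` per observation (`lintegral_likRatio_mul`). Blocks are selected independently, so
averaging factorizes and bounds the second moment by `(1 + (e^{2nr} - 1)/B)^m`.

For large `p`, take `m = k - k₁`, `r = η log p / n`, `B ≈ p/m`: the excess is governed by `m²
p^{2η-1}`, which vanishes because `γ < 1/2`. For bounded `p`, `k` and `log p` are bounded and one
spike of order `σ/√n` suffices. -/

namespace SparseCI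

open scoped ENNReal NNReal

/-! ### Product measures and the χ² comparison -/

/-- Products of functions of single coordinates integrate to products under a product measure. -/
lemma lintegral_pi_prod {ι Ω : Type*} [Fintype ι] [MeasurableSpace Ω] (μ : Measure Ω)
    [IsProbabilityMeasure μ] (g : ι → Ω → ℝ≥0∞) (hg : ∀ i, Measurable (g i)) :
    ∫⁻ z, ∏ i, g i (z i) ∂(Measure.pi fun _ : ι => μ) = ∏ i, ∫⁻ x, g i x ∂μ := by
  rw [lintegral_prod_eq_prod_lintegral_of_indepFun Finset.univ
    (fun i (z : ι → Ω) => g i (z i)) (iIndepFun_pi fun i => (hg i).aemeasurable)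
    (fun i => (hg i).comp (measurable_pi_apply i))]
  refine Finset.prod_congr rfl fun i _ => ?_
  exact (measurePreserving_eval (fun _ : ι => μ) i).lintegral_comp (hg i)

lemma pi_withDensity {ι Ω : Type*} [Fintype ι] [MeasurableSpace Ω] (μ ν : Measure Ω)
    [IsProbabilityMeasure μ] [IsProbabilityMeasure ν] (h : Ω → ℝ≥0∞) (hh : Measurable h)
    (hν : ν = μ.withDensity h) :
    Measure.pi (fun _ : ι => ν) =
      (Measure.pi fun _ : ι => μ).withDensity fun z => ∏ i, h (z i) := by
  refine Measure.pi_eq fun s hs => ?_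
  rw [withDensity_apply _ (MeasurableSet.univ_pi hs),
    ← lintegral_indicator (MeasurableSet.univ_pi hs)]
  have hprod : ∀ z : ι → Ω, (Set.univ.pi s).indicator (fun z => ∏ i, h (z i)) z =
      ∏ i, (s i).indicator h (z i) := by
    intro z
    by_cases hz : z ∈ Set.univ.pi s
    · rw [Set.indicator_of_mem hz]
      exact Finset.prod_congr rfl fun i _ => (Set.indicator_of_mem (hz i trivial) _).symm
    · rw [Set.indicator_of_notMem hz]
      simp only [Set.mem_pi, Set.mem_univ, true_imp_iff, not_forall] at hz
      obtain ⟨i, hi⟩ := hz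
      exact (Finset.prod_eq_zero (Finset.mem_univ i) (Set.indicator_of_notMem hi _)).symm
  simp_rw [hprod]
  rw [lintegral_pi_prod μ _ fun i => hh.indicator (hs i)]
  refine Finset.prod_congr rfl fun i _ => ?_
  rw [lintegral_indicator (hs i), hν, withDensity_apply _ (hs i)]

/-- A density whose second moment is at most `1 + t²` changes probabilities by at most `t`. -/
lemma withDensity_le_add {Ω : Type*} [MeasurableSpace Ω] (P : Measure Ω) [IsProbabilityMeasure P]
    (h : Ω → ℝ≥0∞) (hh : Measurable h) (h1 : ∫⁻ z, h z ∂P = 1) (t : ℝ≥0) (ht : 0 < t)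
    (h2 : ∫⁻ z, h z * h z ∂P ≤ 1 + (t : ℝ≥0∞) ^ 2) (A : Set Ω) (hA : MeasurableSet A) :
    ∫⁻ z in A, h z ∂P ≤ P A + t := by
  -- Used with `a = 1 + t` on `A` and `a = 1` off `A`. Adding the two gives `2t ∫_A h ≤ (2t + t²)
  -- P(A) + t²`, and `P(A) ≤ 1` finishes.
  have hsq : ∀ (a : ℝ≥0) (x : ℝ≥0∞), 2 * a * x ≤ (a : ℝ≥0∞) ^ 2 + x * x := by
    intro a x
    induction x with
    | top => simp
    | coe x =>
      norm_cast
      rw [← NNReal.coe_le_coe]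
      push_cast
      nlinarith [sq_nonneg ((a : ℝ) - x)]
  have hA1 : 2 * ((1 + t : ℝ≥0) : ℝ≥0∞) * ∫⁻ z in A, h z ∂P ≤
      ((1 + t : ℝ≥0) : ℝ≥0∞) ^ 2 * P A + ∫⁻ z in A, h z * h z ∂P := by
    rw [← lintegral_const_mul _ hh]
    refine (lintegral_mono fun z => hsq (1 + t) (h z)).trans_eq ?_
    rw [lintegral_add_left measurable_const, setLIntegral_const]
  have hA2 : 2 * ((1 : ℝ≥0) : ℝ≥0∞) * ∫⁻ z in Aᶜ, h z ∂P ≤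
      ((1 : ℝ≥0) : ℝ≥0∞) ^ 2 * P Aᶜ + ∫⁻ z in Aᶜ, h z * h z ∂P := by
    rw [← lintegral_const_mul _ hh]
    refine (lintegral_mono fun z => hsq 1 (h z)).trans_eq ?_
    rw [lintegral_add_left measurable_const, setLIntegral_const]
  have e1 := lintegral_add_compl h hA (μ := P)
  have e2 := lintegral_add_compl (fun z => h z * h z) hA (μ := P)
  have e3 := measure_add_measure_compl hA (μ := P)
  rw [h1] at e1
  rw [measure_univ] at e3
  rw [← e2] at h2
  have ne : ∀ {a b : ℝ≥0∞} (c : ℝ≥0), a + b ≤ c → ∃ x y : ℝ≥0, a = x ∧ b = y := by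
    intro a b c hab
    have := lt_of_le_of_lt hab ENNReal.coe_lt_top
    rw [ENNReal.add_lt_top] at this
    exact ⟨a.toNNReal, b.toNNReal, (ENNReal.coe_toNNReal this.1.ne).symm,
      (ENNReal.coe_toNNReal this.2.ne).symm⟩
  obtain ⟨x1, y1, hx1, hy1⟩ := ne 1 e1.le
  obtain ⟨x2, y2, hx2, hy2⟩ := ne (1 + t ^ 2) (by exact_mod_cast h2)
  obtain ⟨x3, y3, hx3, hy3⟩ := ne 1 e3.le
  rw [hx1, hy1] at e1
  rw [hx2, hy2] at h2
  rw [hx3, hy3] at e3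
  rw [hx1, hx2, hx3] at hA1
  rw [hy1, hy2, hy3] at hA2
  rw [hx1, hx3]
  norm_cast at *
  rw [← NNReal.coe_le_coe] at hA1 hA2 h2 ⊢
  rw [← NNReal.coe_inj] at e1 e3
  push_cast at *
  have ht' : (0 : ℝ) < t := ht
  have hx3' : (x3 : ℝ) ≤ 1 := by have := y3.2; simp only [NNReal.val_eq_coe] at this; linarith
  have key : 2 * (t : ℝ) * x1 ≤ 2 * t * (x3 + t) := by nlinarith
  exact le_of_mul_le_mul_left key (by positivity)

/-! ### One-dimensional Gaussian ratios and covariances -/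

section Gaussian

lemma lintegral_gaussianPDF_mul (μ : ℝ) {v : ℝ≥0} (hv : v ≠ 0) {c : ℝ} (hc : c ≠ 0) :
    ∫⁻ y, gaussianPDF μ v (c * y) = ENNReal.ofReal |c⁻¹| := by
  have hv' : (NNReal.mk (c ^ 2)⁻¹ (inv_nonneg.mpr (sq_nonneg c)) * v : ℝ≥0) ≠ 0 := by
    refine mul_ne_zero ?_ hv
    rw [Ne, ← NNReal.coe_inj]
    simpa using hc
  have : ∀ y, gaussianPDF μ v (c * y) = ENNReal.ofReal |c⁻¹| *
      gaussianPDF (c⁻¹ * μ) (.mk (c ^ 2)⁻¹ (inv_nonneg.mpr (sq_nonneg _)) * v) y := by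
    intro y
    rw [gaussianPDF, gaussianPDFReal_mul hc, ENNReal.ofReal_mul (abs_nonneg _), gaussianPDF]
  simp_rw [this]
  rw [lintegral_const_mul _ (measurable_gaussianPDF _ _), lintegral_gaussianPDF_eq_one _ hv',
    mul_one]

lemma gaussianPDF_sub (μ : ℝ) (v : ℝ≥0) (x y : ℝ) :
    gaussianPDF μ v (x - y) = gaussianPDF (μ + y) v x := by
  rw [gaussianPDF, gaussianPDFReal_sub, gaussianPDF]

/-- If `w ∼ N(0, V)` and `ζ` are independent, then the density ratio between `N(b w + ζ, d)` and
`N(0, V)`, evaluated at `w`, has mean `1 / (1 - b)`. -/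
lemma lintegral_gaussianPDF_ratio (ν : Measure ℝ) [IsProbabilityMeasure ν] {V d : ℝ≥0}
    (hV : V ≠ 0) (hd : d ≠ 0) {b : ℝ} (hb : b < 1) :
    ∫⁻ q, gaussianPDF (b * q.1 + q.2) d q.1 / gaussianPDF 0 V q.1
      ∂((gaussianReal 0 V).prod ν) = ENNReal.ofReal (1 - b)⁻¹ := by
  have hmeas : Measurable fun q : ℝ × ℝ =>
      gaussianPDF (b * q.1 + q.2) d q.1 / gaussianPDF 0 V q.1 := by
    refine Measurable.div ?_ ((measurable_gaussianPDF _ _).comp measurable_fst)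
    exact measurable_uncurry_gaussianPDF.comp
      (f := fun q : ℝ × ℝ => (b * q.1 + q.2, d, q.1)) (by fun_prop)
  rw [lintegral_prod_symm' _ hmeas]
  have inner : ∀ z : ℝ, ∫⁻ w, gaussianPDF (b * w + z) d w / gaussianPDF 0 V w
      ∂(gaussianReal 0 V) = ENNReal.ofReal (1 - b)⁻¹ := by
    intro z
    have hz : Measurable fun w => gaussianPDF (b * w + z) d w / gaussianPDF 0 V w :=
      hmeas.comp (f := fun w : ℝ => (w, z)) (by fun_prop)
    rw [gaussianReal_of_var_ne_zero _ hV, lintegral_withDensity_eq_lintegral_mul _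
      (measurable_gaussianPDF _ _) hz]
    -- The weight cancels the denominator; what remains integrates to the Jacobian `1/(1 - b)`,
    -- whatever `z` is.
    have : ∀ w, (gaussianPDF 0 V * fun w => gaussianPDF (b * w + z) d w / gaussianPDF 0 V w) w =
        gaussianPDF z d ((1 - b) * w) := by
      intro w
      rw [Pi.mul_apply, ENNReal.mul_div_cancel (gaussianPDF_pos _ hV _).ne' gaussianPDF_ne_top,
        show (1 - b) * w = w - b * w by ring, gaussianPDF_sub, add_comm]
    rw [lintegral_congr this, lintegral_gaussianPDF_mul _ hd (by linarith), abs_of_pos]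
    exact inv_pos.2 (by linarith)
  simp [inner]

variable {p : ℕ}

/-- The linear functional `x ↦ xᵀa` in coordinates. -/
lemma inner_toLp_eq_sum (a : Fin p → ℝ) (x : EuclideanSpace ℝ (Fin p)) :
    inner ℝ (WithLp.toLp 2 a) x = ∑ j, x j * a j := by
  simp [PiLp.inner_apply]

/-- Covariance of two affine functionals of a standard design row and its noise. -/
lemma covariance_sum_add (d : ℝ≥0) (a b : Fin p → ℝ) (s t : ℝ) :
    cov[fun w : EuclideanSpace ℝ (Fin p) × ℝ => ∑ j, w.1 j * a j + s * w.2,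
      fun w => ∑ j, w.1 j * b j + t * w.2;
      (stdGaussian (EuclideanSpace ℝ (Fin p))).prod (gaussianReal 0 d)] =
      ∑ j, a j * b j + s * t * d := by
  set G := stdGaussian (EuclideanSpace ℝ (Fin p))
  set N := gaussianReal 0 d
  have hX : ∀ a : Fin p → ℝ, MemLp (fun x : EuclideanSpace ℝ (Fin p) => ∑ j, x j * a j) 2 G := by
    intro a
    have := (IsGaussian.hasGaussianLaw_id (μ := G)).map (innerSL ℝ (WithLp.toLp 2 a))
    have := this.memLp_two
    refine this.congr_norm (by fun_prop) (.of_forall fun x => ?_)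
    simp [← inner_toLp_eq_sum]
  have hE : ∀ s : ℝ, MemLp (fun x : ℝ => s * x) 2 N := fun s =>
    (memLp_id_gaussianReal 2).const_mul s
  have hX' : ∀ a : Fin p → ℝ, MemLp (fun w : EuclideanSpace ℝ (Fin p) × ℝ => ∑ j, w.1 j * a j) 2
      (G.prod N) := fun a => (hX a).comp_fst N
  have hE' : ∀ s : ℝ, MemLp (fun w : EuclideanSpace ℝ (Fin p) × ℝ => s * w.2) 2
      (G.prod N) := fun s => (hE s).comp_snd G
  have hind : ∀ (a : Fin p → ℝ) (s : ℝ), cov[fun w : EuclideanSpace ℝ (Fin p) × ℝ =>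
      ∑ j, w.1 j * a j, fun w => s * w.2; G.prod N] = 0 := fun a s =>
    covariance_fst_snd_prod (hX a) (hE s)
  have hind' : cov[fun w : EuclideanSpace ℝ (Fin p) × ℝ => s * w.2,
      fun w => ∑ j, w.1 j * b j; G.prod N] = 0 := by
    rw [covariance_comm]
    exact hind b s
  have hxx : cov[fun w : EuclideanSpace ℝ (Fin p) × ℝ => ∑ j, w.1 j * a j,
      fun w => ∑ j, w.1 j * b j; G.prod N] = ∑ j, a j * b j := by
    have h1 := covariance_map_fun (μ := G.prod N) (Z := Prod.fst)
      (X := fun x : EuclideanSpace ℝ (Fin p) => ∑ j, x j * a j) (Y := fun x => ∑ j, x j * b j)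
      (by fun_prop) (by fun_prop) (by fun_prop)
    rw [← h1, Measure.map_fst_prod, measure_univ, one_smul]
    have h2 := covarianceBilin_apply_eq_cov (μ := G) IsGaussian.memLp_two_id
      (WithLp.toLp 2 a) (WithLp.toLp 2 b)
    simp_rw [inner_toLp_eq_sum] at h2
    rw [← h2, covarianceBilin_stdGaussian, innerSL_apply_apply, inner_toLp_eq_sum]
    simp [mul_comm]
  have hee : cov[fun w : EuclideanSpace ℝ (Fin p) × ℝ => s * w.2,
      fun w => t * w.2; G.prod N] = s * t * d := by
    have h1 := covariance_map_fun (μ := G.prod N) (Z := Prod.snd)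
      (X := fun x : ℝ => s * x) (Y := fun x => t * x)
      (by fun_prop) (by fun_prop) (by fun_prop)
    rw [← h1, Measure.map_snd_prod, measure_univ, one_smul, covariance_const_mul_left,
      covariance_const_mul_right, covariance_self (by fun_prop), variance_fun_id_gaussianReal]
    ring
  have := covariance_add_left (hX' a) (hE' s) ((hX' b).add (hE' t))
  rw [covariance_add_right (hX' a) (hX' b) (hE' t), covariance_add_right (hE' s) (hX' b) (hE' t),
    hxx, hind, hind', hee] at this
  rw [add_zero, zero_add] at this
  exact this

end Gaussian

/-! ### Likelihood ratio of a single observation -/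

section Gaussian
variable {p : ℕ}

/-- The response noise `w = xᵀa + ε` and the residual of `xᵀa'` after regression on `w` are
independent. -/
lemma map_response_residual (d V : ℝ≥0) (a a' : Fin p → ℝ) (b : ℝ)
    (hV : (V : ℝ) = ∑ j, a j * a j + d) (hb : ∑ j, a j * a' j = b * V) :
    ∃ ν : Measure ℝ, IsProbabilityMeasure ν ∧
      ((stdGaussian (EuclideanSpace ℝ (Fin p))).prod (gaussianReal 0 d)).map
        (fun w => (∑ j, w.1 j * a j + w.2,
          ∑ j, w.1 j * a' j - b * (∑ j, w.1 j * a j + w.2))) =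
      (gaussianReal 0 V).prod ν := by
  set G := stdGaussian (EuclideanSpace ℝ (Fin p))
  set N := gaussianReal 0 d
  set W : EuclideanSpace ℝ (Fin p) × ℝ → ℝ := fun w => ∑ j, w.1 j * a j + w.2 with hW
  set Z : EuclideanSpace ℝ (Fin p) × ℝ → ℝ := fun w =>
    ∑ j, w.1 j * a' j - b * (∑ j, w.1 j * a j + w.2) with hZ
  have hWm : Measurable W := by fun_prop
  have hZm : Measurable Z := by fun_prop
  have hWe : W = fun w => ∑ j, w.1 j * a j + 1 * w.2 := by simp [hW]
  have hZe : Z = fun w => ∑ j, w.1 j * (a' j - b * a j) + (-b) * w.2 := by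
    funext w
    simp only [hZ, mul_sub, Finset.sum_sub_distrib, mul_add, Finset.mul_sum, neg_mul]
    have : ∀ j, w.1 j * (b * a j) = b * (w.1 j * a j) := fun j => by ring
    simp_rw [this]
    ring
  let lin : (Fin p → ℝ) → ℝ → (EuclideanSpace ℝ (Fin p) × ℝ →L[ℝ] ℝ) := fun a s =>
    (innerSL ℝ (WithLp.toLp 2 a)).comp (ContinuousLinearMap.fst ℝ _ _) +
      s • ContinuousLinearMap.snd ℝ _ _
  have hlin : ∀ a s w, lin a s w = ∑ j, w.1 j * a j + s * w.2 := by
    intro a s w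
    simp [lin, ← inner_toLp_eq_sum]
  have hgauss : HasGaussianLaw (fun w => (W w, Z w)) (G.prod N) := by
    have := (IsGaussian.hasGaussianLaw_id (μ := G.prod N)).map_fun
      ((lin a 1).prod (lin (fun j => a' j - b * a j) (-b)))
    simpa only [ContinuousLinearMap.prod_apply, id, hlin, hWe, hZe] using this
  -- `b` is the regression coefficient, so the covariance is `bV - bV = 0`; joint Gaussianity
  -- upgrades this to independence.
  have hind : IndepFun W Z (G.prod N) := by
    refine hgauss.indepFun_of_covariance_eq_zero ?_
    rw [hWe, hZe, covariance_sum_add]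
    have : ∀ j, a j * (a' j - b * a j) = a j * a' j - b * (a j * a j) := fun j => by ring
    simp_rw [this, Finset.sum_sub_distrib, ← Finset.mul_sum]
    rw [hb, hV]
    ring
  have hlawW : (G.prod N).map W = gaussianReal 0 V := by
    rw [hgauss.fst.map_eq_gaussianReal]
    have hmean : (∫ w, W w ∂(G.prod N)) = 0 := by
      have h1 : Integrable (fun w : EuclideanSpace ℝ (Fin p) × ℝ => ∑ j, w.1 j * a j)
          (G.prod N) := by
        have := (IsGaussian.hasGaussianLaw_id (μ := G.prod N)).map_fun (lin a 0)
        simpa [hlin] using this.integrable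
      have h2 : Integrable (fun w : EuclideanSpace ℝ (Fin p) × ℝ => w.2) (G.prod N) := by
        have := (IsGaussian.hasGaussianLaw_id (μ := G.prod N)).map_fun (lin 0 1)
        simpa [hlin] using this.integrable
      rw [hW, integral_add h1 h2]
      have e1 := integral_fun_fst (μ := G) (ν := N)
        (fun x : EuclideanSpace ℝ (Fin p) => ∑ j, x j * a j)
      have e2 := integral_fun_snd (μ := G) (ν := N) (fun x : ℝ => x)
      rw [e1, e2]
      have e3 := integral_strongDual_stdGaussian (innerSL ℝ (WithLp.toLp 2 a))
      simp only [innerSL_apply_apply, inner_toLp_eq_sum] at e3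
      simp [G, e3, N]
    have hvar : Var[W; G.prod N] = V := by
      rw [← covariance_self hWm.aemeasurable, hWe, covariance_sum_add, hV]
      ring
    rw [hmean, hvar, Real.toNNReal_coe]
  refine ⟨(G.prod N).map Z, Measure.isProbabilityMeasure_map hZm.aemeasurable, ?_⟩
  rw [← hlawW]
  exact (indepFun_iff_map_prod_eq_prod_map_map hWm.aemeasurable hZm.aemeasurable).1 hind

/-- The conditional density of the response given the design row, for noise variance `V`. -/
noncomputable def respPDF (b : Fin p → ℝ) (V : ℝ≥0) (z : Obs p) : ℝ≥0∞ :=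
  gaussianPDF (∑ j, z.2 j * b j) V z.1

lemma measurable_respPDF (b : Fin p → ℝ) (V : ℝ≥0) : Measurable (respPDF b V) :=
  measurable_uncurry_gaussianPDF.comp
    (f := fun z : Obs p => (∑ j, z.2 j * b j, V, z.1)) (by fun_prop)

lemma measurable_obs (b : Fin p → ℝ) :
    Measurable fun w : EuclideanSpace ℝ (Fin p) × ℝ => (∑ j, w.1 j * b j + w.2, w.1) := by
  fun_prop

instance isProbabilityMeasure_obsLaw (θ : Param p) : IsProbabilityMeasure (obsLaw θ) :=
  Measure.isProbabilityMeasure_map (measurable_obs θ.beta).aemeasurable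

lemma obsLaw_one (b : Fin p → ℝ) (s : ℝ) :
    obsLaw (⟨b, 1, s⟩ : Param p) =
      ((stdGaussian (EuclideanSpace ℝ (Fin p))).prod (gaussianReal 0 (s ^ 2).toNNReal)).map
        fun w => (∑ j, w.1 j * b j + w.2, w.1) := by
  rw [obsLaw]
  simp only [inv_one, multivariateGaussian_zero_one]

lemma lintegral_obsLaw (b : Fin p → ℝ) (s : ℝ) (hs : (s ^ 2).toNNReal ≠ 0) (F : Obs p → ℝ≥0∞)
    (hF : Measurable F) :
    ∫⁻ z, F z ∂(obsLaw (⟨b, 1, s⟩ : Param p)) =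
      ∫⁻ x, (∫⁻ y, respPDF b (s ^ 2).toNNReal (y, x) * F (y, x))
        ∂(stdGaussian (EuclideanSpace ℝ (Fin p))) := by
  have hm := measurable_obs b
  rw [obsLaw_one, lintegral_map hF hm,
    lintegral_prod (fun w : EuclideanSpace ℝ (Fin p) × ℝ => F (∑ j, w.1 j * b j + w.2, w.1)) (hF.comp hm).aemeasurable]
  refine lintegral_congr fun x => ?_
  have hFx : Measurable fun y => F (y, x) := hF.comp (measurable_id.prodMk measurable_const)
  have h1 := lintegral_map (μ := gaussianReal 0 (s ^ 2).toNNReal) hFx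
    (measurable_const_add (∑ j, x j * b j))
  rw [← h1, gaussianReal_map_const_add, zero_add, gaussianReal_of_var_ne_zero _ hs,
    lintegral_withDensity_eq_lintegral_mul _ (measurable_gaussianPDF _ _) hFx]
  rfl

/-- The likelihood ratio of one observation. -/
noncomputable def likRatio (b₀ : Fin p → ℝ) (V₀ : ℝ≥0) (b₁ : Fin p → ℝ) (V₁ : ℝ≥0) (z : Obs p) :
    ℝ≥0∞ :=
  respPDF b₁ V₁ z / respPDF b₀ V₀ z

lemma measurable_likRatio (b₀ : Fin p → ℝ) (V₀ : ℝ≥0) (b₁ : Fin p → ℝ) (V₁ : ℝ≥0) :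
    Measurable (likRatio b₀ V₀ b₁ V₁) :=
  (measurable_respPDF _ _).div (measurable_respPDF _ _)

/-- Both parameters have the same design law, so only the conditional densities of the response
enter the ratio. -/
lemma obsLaw_eq_withDensity (b₀ b₁ : Fin p → ℝ) (s₀ s₁ : ℝ) (h₀ : (s₀ ^ 2).toNNReal ≠ 0)
    (h₁ : (s₁ ^ 2).toNNReal ≠ 0) :
    obsLaw (⟨b₁, 1, s₁⟩ : Param p) = (obsLaw (⟨b₀, 1, s₀⟩ : Param p)).withDensity
      (likRatio b₀ (s₀ ^ 2).toNNReal b₁ (s₁ ^ 2).toNNReal) := by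
  refine Measure.ext_of_lintegral _ fun F hF => ?_
  have hl := measurable_likRatio b₀ (s₀ ^ 2).toNNReal b₁ (s₁ ^ 2).toNNReal
  rw [lintegral_withDensity_eq_lintegral_mul _ hl hF, lintegral_obsLaw _ _ h₁ _ hF,
    lintegral_obsLaw _ _ h₀ _ (hl.mul hF)]
  refine lintegral_congr fun x => lintegral_congr fun y => ?_
  rw [Pi.mul_apply, ← mul_assoc, likRatio, ENNReal.mul_div_cancel]
  · exact (gaussianPDF_pos _ h₀ _).ne'
  · exact gaussianPDF_ne_top

/-- Correlation of two likelihood ratios whose alternatives have the same marginal variance of the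
response as the null. -/
lemma lintegral_likRatio_mul (b₀ a a' : Fin p → ℝ) (s₀ s₁ : ℝ) (h₀ : (s₀ ^ 2).toNNReal ≠ 0)
    (h₁ : (s₁ ^ 2).toNNReal ≠ 0) (hvar : s₀ ^ 2 = ∑ j, a j * a j + s₁ ^ 2) (c : ℝ)
    (hc : ∑ j, a j * a' j = c * s₀ ^ 2) (hc1 : c < 1) :
    ∫⁻ z, likRatio b₀ (s₀ ^ 2).toNNReal (b₀ + a) (s₁ ^ 2).toNNReal z *
        likRatio b₀ (s₀ ^ 2).toNNReal (b₀ + a') (s₁ ^ 2).toNNReal z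
      ∂(obsLaw (⟨b₀, 1, s₀⟩ : Param p)) = ENNReal.ofReal (1 - c)⁻¹ := by
  have hl := measurable_likRatio b₀ (s₀ ^ 2).toNNReal (b₀ + a) (s₁ ^ 2).toNNReal
  have hl' := measurable_likRatio b₀ (s₀ ^ 2).toNNReal (b₀ + a') (s₁ ^ 2).toNNReal
  -- One ratio is absorbed as a change of measure to the alternative `a`. There `y - xᵀb₀ = xᵀa + ε`
  -- has law `N(0, s₀²)` by `hvar`, and `xᵀa'` is `c` times it plus an independent residual.
  have h2 := lintegral_withDensity_eq_lintegral_mul (obsLaw (⟨b₀, 1, s₀⟩ : Param p)) hl hl'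
  simp only [Pi.mul_apply] at h2
  rw [← h2, ← obsLaw_eq_withDensity _ _ _ _ h₀ h₁, obsLaw_one,
    lintegral_map hl' (measurable_obs _)]
  obtain ⟨ν, hν, hmap⟩ := map_response_residual (s₁ ^ 2).toNNReal (s₀ ^ 2).toNNReal a a' c
    (by rw [Real.coe_toNNReal _ (sq_nonneg _), Real.coe_toNNReal _ (sq_nonneg _), hvar])
    (by rw [Real.coe_toNNReal _ (sq_nonneg _), hc])
  rw [← lintegral_gaussianPDF_ratio ν h₀ h₁ hc1, ← hmap, lintegral_map]
  · refine lintegral_congr fun w => ?_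
    simp only [likRatio, respPDF, Pi.add_apply]
    have e : ∀ a : Fin p → ℝ, ∑ j, w.1 j * (b₀ j + a j) =
        ∑ j, w.1 j * b₀ j + ∑ j, w.1 j * a j := by
      intro a
      rw [← Finset.sum_add_distrib]
      exact Finset.sum_congr rfl fun j _ => by ring
    simp only [e]
    set u := ∑ j, w.1 j * b₀ j
    set v := ∑ j, w.1 j * a j
    set v' := ∑ j, w.1 j * a' j
    rw [show c * (v + w.2) + (v' - c * (v + w.2)) = v' by ring,
      show u + v' = v' + u by ring, ← gaussianPDF_sub,
      show (gaussianPDF u (s₀ ^ 2).toNNReal (u + v + w.2)) =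
        gaussianPDF 0 (s₀ ^ 2).toNNReal (u + v + w.2 - u) by rw [gaussianPDF_sub, zero_add],
      show u + v + w.2 - u = v + w.2 by ring]
  · refine Measurable.div ?_ ((measurable_gaussianPDF _ _).comp measurable_fst)
    exact measurable_uncurry_gaussianPDF.comp
      (f := fun q : ℝ × ℝ => (c * q.1 + q.2, (s₁ ^ 2).toNNReal, q.1)) (by fun_prop)
  · fun_prop

end Gaussian

/-! ### The block-spike prior -/

section Prior
variable {p m B : ℕ}

/-- The vector with value `ρ` at one coordinate of each of `m` disjoint blocks of size `B`; the
coordinate in block `i` is selected by `f i`. -/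
noncomputable def blockSpike (e : Fin m × Fin B ↪ Fin p) (ρ : ℝ) (f : Fin m → Fin B) :
    Fin p → ℝ :=
  fun j => ∑ i, if e (i, f i) = j then ρ else 0

lemma sum_blockSpike (e : Fin m × Fin B ↪ Fin p) (ρ : ℝ) (f : Fin m → Fin B) :
    ∑ j, blockSpike e ρ f j = m * ρ := by
  simp only [blockSpike]
  rw [Finset.sum_comm]
  simp

/-- Injectivity of `e` prevents spikes of different blocks from meeting, so only agreements
contribute. -/
lemma sum_blockSpike_mul (e : Fin m × Fin B ↪ Fin p) (ρ : ℝ) (f g : Fin m → Fin B) :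
    ∑ j, blockSpike e ρ f j * blockSpike e ρ g j = ∑ i, if f i = g i then ρ ^ 2 else 0 := by
  simp only [blockSpike, Finset.sum_mul_sum]
  rw [Finset.sum_comm]
  refine Finset.sum_congr rfl fun i _ => ?_
  rw [Finset.sum_comm, Finset.sum_eq_single i]
  · simp [pow_two, eq_comm]
  · intro i' _ hi'
    simp [Ne.symm hi']
  · simp

lemma hammingNorm_blockSpike (e : Fin m × Fin B ↪ Fin p) (ρ : ℝ) (f : Fin m → Fin B) :
    hammingNorm (blockSpike e ρ f) ≤ m := by
  rw [hammingNorm]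
  have : (Finset.univ.filter fun j => blockSpike e ρ f j ≠ 0) ⊆
      Finset.univ.image fun i => e (i, f i) := by
    intro j hj
    simp only [Finset.mem_filter, Finset.mem_univ, true_and] at hj
    obtain ⟨i, _, hi⟩ := Finset.exists_ne_zero_of_sum_ne_zero hj
    refine Finset.mem_image.2 ⟨i, Finset.mem_univ _, ?_⟩
    by_contra h
    exact hi (if_neg h)
  refine (Finset.card_le_card this).trans (Finset.card_image_le.trans ?_)
  simp

lemma hammingNorm_add_le (a b : Fin p → ℝ) :
    hammingNorm (a + b) ≤ hammingNorm a + hammingNorm b := by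
  have := hammingDist_triangle (a + b) b 0
  simp only [hammingDist_zero_right] at this
  rwa [hammingDist_comm, hammingDist_eq_hammingNorm, neg_add_eq_sub, add_sub_cancel_right] at this

/-- Moment generating function of the number of agreements of two independent uniform selections. -/
lemma sum_prod_agree (E : ℝ) (f : Fin m → Fin B) :
    ∑ g : Fin m → Fin B, ∏ i, (if f i = g i then E else 1) = (E + (B - 1)) ^ m := by
  have h := Finset.prod_univ_sum (fun _ : Fin m => (Finset.univ : Finset (Fin B)))
    (fun i b => if f i = b then E else 1)
  rw [Fintype.piFinset_univ] at h
  rw [← h]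
  have : ∀ i, ∑ b : Fin B, (if f i = b then E else 1) = E + (B - 1) := by
    intro i
    have hb : ∀ b : Fin B, (if f i = b then E else 1) = 1 + (if f i = b then E - 1 else 0) := by
      intro b
      split_ifs <;> ring
    simp_rw [hb, Finset.sum_add_distrib]
    simp
    ring
  simp [this]

/-- Makes the correlation multiplicative over blocks. `(1 - c)(1 + 2c) = 1 + c(1 - 2c)` is where `c
≤ 1/2` enters. -/
lemma inv_one_sub_le_exp {c : ℝ} (h0 : 0 ≤ c) (h1 : c ≤ 1 / 2) :
    (1 - c)⁻¹ ≤ Real.exp (2 * c) := by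
  have h2 : (1 - c)⁻¹ ≤ 2 * c + 1 := by
    rw [inv_le_iff_one_le_mul₀ (by linarith)]
    nlinarith
  exact h2.trans (Real.add_one_le_exp _)

end Prior

/-! ### Mixture likelihood ratio and the length bound -/

section Mixture
variable {n p m B : ℕ}

instance isProbabilityMeasure_dataLaw (θ : Param p) : IsProbabilityMeasure (dataLaw n θ) := by
  rw [dataLaw]
  infer_instance

/-- Likelihood ratio of the uniform mixture over all block spikes. -/
noncomputable def mixRatio (n : ℕ) (e : Fin m × Fin B ↪ Fin p) (ρ : ℝ) (β : Fin p → ℝ) (s₀ s₁ : ℝ)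
    (z : Fin n → Obs p) : ℝ≥0∞ :=
  ∑ f : Fin m → Fin B, ENNReal.ofReal ((B : ℝ) ^ m)⁻¹ *
    ∏ i, likRatio β (s₀ ^ 2).toNNReal (β + blockSpike e ρ f) (s₁ ^ 2).toNNReal (z i)

lemma measurable_prod_likRatio (b₀ : Fin p → ℝ) (V₀ : ℝ≥0) (b₁ : Fin p → ℝ) (V₁ : ℝ≥0) :
    Measurable fun z : Fin n → Obs p => ∏ i, likRatio b₀ V₀ b₁ V₁ (z i) :=
  Finset.measurable_fun_prod _ fun i _ =>
    (measurable_likRatio _ _ _ _).comp (measurable_pi_apply i)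

lemma measurable_mixRatio (e : Fin m × Fin B ↪ Fin p) (ρ : ℝ) (β : Fin p → ℝ) (s₀ s₁ : ℝ) :
    Measurable (mixRatio n e ρ β s₀ s₁) :=
  Finset.measurable_fun_sum _ fun _ _ => (measurable_prod_likRatio _ _ _ _).const_mul _

lemma sum_ofReal_inv_pow (hB : 1 ≤ B) :
    ∑ _f : Fin m → Fin B, ENNReal.ofReal ((B : ℝ) ^ m)⁻¹ = 1 := by
  have hB' : (0 : ℝ) < B := by exact_mod_cast hB
  rw [← ENNReal.ofReal_sum_of_nonneg (fun _ _ => by positivity)]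
  simp [hB'.ne']

lemma setLIntegral_mixRatio (e : Fin m × Fin B ↪ Fin p) (ρ : ℝ) (β : Fin p → ℝ) (s₀ s₁ : ℝ)
    (h₀ : (s₀ ^ 2).toNNReal ≠ 0) (h₁ : (s₁ ^ 2).toNNReal ≠ 0) (A : Set (Fin n → Obs p))
    (hA : MeasurableSet A) :
    ∫⁻ z in A, mixRatio n e ρ β s₀ s₁ z ∂(dataLaw n (⟨β, 1, s₀⟩ : Param p)) =
      ∑ f : Fin m → Fin B, ENNReal.ofReal ((B : ℝ) ^ m)⁻¹ *
        dataLaw n (⟨β + blockSpike e ρ f, 1, s₁⟩ : Param p) A := by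
  simp only [mixRatio]
  rw [lintegral_finsetSum _ fun f _ => (measurable_prod_likRatio _ _ _ _).const_mul _]
  refine Finset.sum_congr rfl fun f _ => ?_
  rw [lintegral_const_mul _ (measurable_prod_likRatio _ _ _ _), ← withDensity_apply _ hA]
  congr 2
  exact (pi_withDensity _ _ _ (measurable_likRatio _ _ _ _)
    (obsLaw_eq_withDensity _ _ _ _ h₀ h₁)).symm

/-- The second moment of the mixture likelihood ratio. -/
lemma lintegral_mixRatio_sq_le (hB : 1 ≤ B) (e : Fin m × Fin B ↪ Fin p) (β : Fin p → ℝ)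
    {r s₀ s₁ ρ : ℝ} (hs₀ : 0 < s₀) (hs₁ : 0 < s₁) (hr : 0 ≤ r) (hmr : m * r ≤ 1 / 2)
    (hρ : ρ ^ 2 = r * s₀ ^ 2) (hvar : s₀ ^ 2 = m * ρ ^ 2 + s₁ ^ 2) :
    ∫⁻ z, mixRatio n e ρ β s₀ s₁ z * mixRatio n e ρ β s₀ s₁ z
      ∂(dataLaw n (⟨β, 1, s₀⟩ : Param p)) ≤
      ENNReal.ofReal ((1 + (Real.exp (2 * n * r) - 1) / B) ^ m) := by
  have hB' : (0 : ℝ) < B := by exact_mod_cast hB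
  have h₀ : (s₀ ^ 2).toNNReal ≠ 0 := (Real.toNNReal_pos.2 (by positivity)).ne'
  have h₁ : (s₁ ^ 2).toNNReal ≠ 0 := (Real.toNNReal_pos.2 (by positivity)).ne'
  set C : ℝ := ((B : ℝ) ^ m)⁻¹ with hC
  have hC0 : 0 ≤ C := by positivity
  set ℓ : (Fin m → Fin B) → Obs p → ℝ≥0∞ := fun f =>
    likRatio β (s₀ ^ 2).toNNReal (β + blockSpike e ρ f) (s₁ ^ 2).toNNReal with hℓ
  have hℓm : ∀ f, Measurable (ℓ f) := fun f => measurable_likRatio _ _ _ _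
  have hpair : ∀ f g : Fin m → Fin B,
      ∫⁻ z, ∏ i, (ℓ f (z i) * ℓ g (z i)) ∂(dataLaw n (⟨β, 1, s₀⟩ : Param p)) ≤
        ENNReal.ofReal (∏ i, if f i = g i then Real.exp (2 * n * r) else 1) := by
    intro f g
    rw [dataLaw, lintegral_pi_prod _ (fun _ x => ℓ f x * ℓ g x)
      fun _ => (hℓm f).mul (hℓm g)]
    -- The inner product of the two spikes divided by `s₀²`.
    set c : ℝ := ∑ i, if f i = g i then r else 0 with hc
    have hc0 : 0 ≤ c := Finset.sum_nonneg fun i _ => by split_ifs <;> simp [hr]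
    have hc1 : c ≤ 1 / 2 := by
      refine le_trans ?_ hmr
      refine (Finset.sum_le_sum fun i _ => show _ ≤ r by split_ifs <;> simp [hr]).trans ?_
      simp
    have hone : ∫⁻ x, ℓ f x * ℓ g x ∂(obsLaw (⟨β, 1, s₀⟩ : Param p)) =
        ENNReal.ofReal (1 - c)⁻¹ := by
      refine lintegral_likRatio_mul β _ _ s₀ s₁ h₀ h₁ ?_ c ?_ (by linarith)
      · rw [sum_blockSpike_mul]
        simpa using hvar
      · rw [sum_blockSpike_mul, hc, Finset.sum_mul, hρ]
        exact Finset.sum_congr rfl fun i _ => by split_ifs <;> simp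
    rw [hone, Finset.prod_const, Finset.card_univ, Fintype.card_fin, ← ENNReal.ofReal_pow
      (inv_nonneg.2 (by linarith))]
    refine ENNReal.ofReal_le_ofReal ?_
    refine (pow_le_pow_left₀ (inv_nonneg.2 (by linarith)) (inv_one_sub_le_exp hc0 hc1) n).trans_eq ?_
    rw [← Real.exp_nat_mul, hc, Finset.mul_sum, Finset.mul_sum, Real.exp_sum]
    refine Finset.prod_congr rfl fun i _ => ?_
    split_ifs
    · congr 1
      ring
    · simp
  have hexp : ∀ z, mixRatio n e ρ β s₀ s₁ z * mixRatio n e ρ β s₀ s₁ z =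
      ∑ f : Fin m → Fin B, ∑ g : Fin m → Fin B,
        (ENNReal.ofReal C * ENNReal.ofReal C) * ∏ i, (ℓ f (z i) * ℓ g (z i)) := by
    intro z
    simp only [mixRatio, Finset.sum_mul_sum]
    refine Finset.sum_congr rfl fun f _ => Finset.sum_congr rfl fun g _ => ?_
    rw [Finset.prod_mul_distrib]
    ring
  have hmm : ∀ f g : Fin m → Fin B,
      Measurable fun z : Fin n → Obs p => ∏ i, (ℓ f (z i) * ℓ g (z i)) := fun f g =>
    Finset.measurable_fun_prod _ fun i _ => ((hℓm f).mul (hℓm g)).comp (measurable_pi_apply i)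
  simp_rw [hexp]
  rw [lintegral_finsetSum _ fun f _ =>
    Finset.measurable_fun_sum _ fun g _ => (hmm f g).const_mul _]
  have hE : ∀ f g : Fin m → Fin B,
      (0 : ℝ) ≤ ∏ i, if f i = g i then Real.exp (2 * n * r) else 1 := fun f g =>
    Finset.prod_nonneg fun i _ => by split_ifs <;> positivity
  have hrow : ∀ f : Fin m → Fin B,
      ∫⁻ z, ∑ g : Fin m → Fin B, (ENNReal.ofReal C * ENNReal.ofReal C) *
        ∏ i, (ℓ f (z i) * ℓ g (z i)) ∂(dataLaw n (⟨β, 1, s₀⟩ : Param p)) ≤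
      ENNReal.ofReal (C * C * (Real.exp (2 * n * r) + (B - 1)) ^ m) := by
    intro f
    rw [lintegral_finsetSum _ fun g _ => (hmm f g).const_mul _, ← sum_prod_agree _ f,
      Finset.mul_sum, ENNReal.ofReal_sum_of_nonneg fun g _ => mul_nonneg (by positivity) (hE f g)]
    refine Finset.sum_le_sum fun g _ => ?_
    rw [lintegral_const_mul _ (hmm f g), ENNReal.ofReal_mul (by positivity),
      ENNReal.ofReal_mul hC0]
    gcongr
    exact hpair f g
  -- The row bound does not depend on `f`, so the `B^m` rows cancel one factor `C`.
  refine (Finset.sum_le_sum fun f _ => hrow f).trans_eq ?_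
  have hpow : 0 ≤ C * C * (Real.exp (2 * n * r) + (B - 1)) ^ m := by
    have : (1 : ℝ) ≤ B := by exact_mod_cast hB
    have : 0 ≤ Real.exp (2 * n * r) + (B - 1) := by
      have := Real.exp_pos (2 * n * r)
      linarith
    positivity
  rw [← ENNReal.ofReal_sum_of_nonneg fun _ _ => hpow]
  congr 1
  rw [Finset.sum_const, Finset.card_univ, Fintype.card_fun, Fintype.card_fin, Fintype.card_fin,
    nsmul_eq_mul, hC]
  have : 1 + (Real.exp (2 * n * r) - 1) / B = (Real.exp (2 * n * r) + (B - 1)) / B := by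
    field_simp
    ring
  rw [this, div_pow]
  push_cast
  field_simp

/-- Expected-length lower bound from a block-spike prior that is nearly indistinguishable from the
null. -/
lemma le_expectedLength_of_blockSpike {M₁ M₂ α : ℝ} {k k₁ : ℕ} (hB : 1 ≤ B)
    (e : Fin m × Fin B ↪ Fin p) (hk : k₁ + m ≤ k) {β : Fin p → ℝ} {σ r t : ℝ}
    (hθ : (⟨β, 1, σ⟩ : Param p) ∈ Theta M₁ M₂ p k₁) (hr : 0 ≤ r) (hmr : m * r ≤ 1 / 2)
    (ht : 0 < t)
    (hchi : (1 + (Real.exp (2 * n * r) - 1) / B) ^ m ≤ 1 + t ^ 2)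
    {CI : Interval n p}
    (hCI : CI ∈ confidenceIntervals n α (Theta M₁ M₂ p k) fun b => ∑ i, b i) :
    ENNReal.ofReal ((1 - 2 * α - t) * (m * (σ * Real.sqrt r))) ≤
      expectedLength (⟨β, 1, σ⟩ : Param p) CI := by
  obtain ⟨hβ, hΩ, hσ, hσM⟩ := hθ
  simp only at hβ hσ hσM
  set ρ := σ * Real.sqrt r with hρdef
  have hρ : ρ ^ 2 = r * σ ^ 2 := by rw [hρdef, mul_pow, Real.sq_sqrt hr]; ring
  have hρ0 : 0 ≤ ρ := by positivity
  -- `mρ² = (mr)σ² ≤ σ²/2`. The reduced noise level also stays below `M₂`.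
  have hd : 0 < σ ^ 2 - m * ρ ^ 2 := by
    have h1 : 0 < σ ^ 2 := by positivity
    have : m * ρ ^ 2 = (m * r) * σ ^ 2 := by rw [hρ]; ring
    rw [this]
    nlinarith
  set s₁ := Real.sqrt (σ ^ 2 - m * ρ ^ 2) with hs₁def
  have hs₁ : 0 < s₁ := Real.sqrt_pos.2 hd
  have hs₁sq : s₁ ^ 2 = σ ^ 2 - m * ρ ^ 2 := Real.sq_sqrt hd.le
  have hs₁σ : s₁ ≤ σ := by
    refine Real.sqrt_le_iff.2 ⟨hσ.le, ?_⟩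
    have : 0 ≤ m * ρ ^ 2 := by positivity
    linarith
  have h₀ : (σ ^ 2).toNNReal ≠ 0 := (Real.toNNReal_pos.2 (by positivity)).ne'
  have h₁ : (s₁ ^ 2).toNNReal ≠ 0 := (Real.toNNReal_pos.2 (by positivity)).ne'
  have hcov : ∀ θ ∈ Theta M₁ M₂ p k, ENNReal.ofReal (1 - α) ≤
      dataLaw n θ {z | CI.lower z ≤ ∑ i, θ.beta i ∧ ∑ i, θ.beta i ≤ CI.upper z} :=
    le_iInf₂_iff.1 hCI
  set P := dataLaw n (⟨β, 1, σ⟩ : Param p) with hP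
  set T := ∑ i, β i with hT
  set A₀ := {z | CI.lower z ≤ T ∧ T ≤ CI.upper z} with hA₀
  set A₁ := {z | CI.lower z ≤ T + m * ρ ∧ T + m * ρ ≤ CI.upper z} with hA₁
  have mA : ∀ c : ℝ, MeasurableSet {z | CI.lower z ≤ c ∧ c ≤ CI.upper z} := fun c =>
    (measurableSet_le CI.measurable_lower measurable_const).inter
      (measurableSet_le measurable_const CI.measurable_upper)
  have cov₀ : ENNReal.ofReal (1 - α) ≤ P A₀ :=
    hcov ⟨β, 1, σ⟩ ⟨hβ.trans (by omega), hΩ, hσ, hσM⟩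
  have cov₁ : ∀ f, ENNReal.ofReal (1 - α) ≤
      dataLaw n (⟨β + blockSpike e ρ f, 1, s₁⟩ : Param p) A₁ := by
    intro f
    have hmem : (⟨β + blockSpike e ρ f, 1, s₁⟩ : Param p) ∈ Theta M₁ M₂ p k := by
      refine ⟨?_, hΩ, hs₁, hs₁σ.trans hσM⟩
      refine (hammingNorm_add_le _ _).trans ?_
      have := hammingNorm_blockSpike e ρ f
      omega
    have := hcov _ hmem
    simpa only [Pi.add_apply, Finset.sum_add_distrib, sum_blockSpike] using this
  have hmix : ENNReal.ofReal (1 - α) ≤ ∫⁻ z in A₁, mixRatio n e ρ β σ s₁ z ∂P := by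
    rw [setLIntegral_mixRatio e ρ β σ s₁ h₀ h₁ A₁ (mA _)]
    calc ENNReal.ofReal (1 - α)
        = ∑ _f : Fin m → Fin B, ENNReal.ofReal ((B : ℝ) ^ m)⁻¹ * ENNReal.ofReal (1 - α) := by
          rw [← Finset.sum_mul, sum_ofReal_inv_pow hB, one_mul]
      _ ≤ _ := Finset.sum_le_sum fun f _ => by gcongr; exact cov₁ f
  have hmix1 : ∫⁻ z, mixRatio n e ρ β σ s₁ z ∂P = 1 := by
    rw [← setLIntegral_univ, setLIntegral_mixRatio e ρ β σ s₁ h₀ h₁ _ MeasurableSet.univ]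
    simp only [measure_univ, mul_one]
    exact sum_ofReal_inv_pow hB
  have hTV : ENNReal.ofReal (1 - α) ≤ P A₁ + ENNReal.ofReal t := by
    refine hmix.trans (withDensity_le_add P _ (measurable_mixRatio _ _ _ _ _) hmix1 t.toNNReal
      (Real.toNNReal_pos.2 ht) ?_ A₁ (mA _))
    refine (lintegral_mixRatio_sq_le hB e β hσ hs₁ hr hmr hρ (by linarith)).trans ?_
    refine (ENNReal.ofReal_le_ofReal hchi).trans_eq ?_
    rw [ENNReal.ofReal_add zero_le_one (by positivity), ENNReal.ofReal_one,
      ENNReal.ofReal_pow ht.le]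
    rfl
  -- Inclusion–exclusion under the null; on `A₀ ∩ A₁` the interval contains two points `mρ` apart.
  have hinter : ENNReal.ofReal (1 - 2 * α - t) ≤ P (A₀ ∩ A₁) := by
    have h1 := measureReal_union_add_inter (μ := P) (s := A₀) (mA (T + m * ρ))
    have h2 : P.real (A₀ ∪ A₁) ≤ 1 := measureReal_le_one
    have h3 : 1 - α ≤ P.real A₀ := by
      rwa [Measure.real, ← ENNReal.ofReal_le_iff_le_toReal (measure_ne_top _ _)]
    have h4 : 1 - α ≤ P.real A₁ + t := by
      have := ENNReal.toReal_mono (ENNReal.add_ne_top.2 ⟨measure_ne_top _ _, ENNReal.ofReal_ne_top⟩)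
        hTV
      rw [ENNReal.toReal_add (measure_ne_top _ _) ENNReal.ofReal_ne_top,
        ENNReal.toReal_ofReal ht.le] at this
      -- The truncated form `max (1 - α) 0` avoids needing the sign of `1 - α`.
      have h5 := ENNReal.toReal_ofReal' (r := 1 - α)
      rw [h5] at this
      exact (le_max_left _ _).trans this
    rw [ENNReal.ofReal_le_iff_le_toReal (measure_ne_top _ _)]
    change _ ≤ P.real (A₀ ∩ A₁)
    linarith
  calc ENNReal.ofReal ((1 - 2 * α - t) * (m * ρ))
      = ENNReal.ofReal (m * ρ) * ENNReal.ofReal (1 - 2 * α - t) := by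
        rw [mul_comm, ENNReal.ofReal_mul (by positivity)]
    _ ≤ ENNReal.ofReal (m * ρ) * P (A₀ ∩ A₁) := by gcongr
    _ = ∫⁻ _ in A₀ ∩ A₁, ENNReal.ofReal (m * ρ) ∂P := by rw [setLIntegral_const]
    _ ≤ ∫⁻ z in A₀ ∩ A₁, ENNReal.ofReal (CI.upper z - CI.lower z) ∂P := by
        refine setLIntegral_mono' ((mA _).inter (mA _)) fun z hz => ?_
        refine ENNReal.ofReal_le_ofReal ?_
        have h1 := hz.1.1
        have h2 := hz.2.2
        linarith
    _ ≤ ∫⁻ z, ENNReal.ofReal (CI.upper z - CI.lower z) ∂P := setLIntegral_le_lintegral _ _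

end Mixture
-- Choice of `m`, `B` and `r`
lemma exists_block_embedding {m B p : ℕ} (h : m * B ≤ p) : Nonempty (Fin m × Fin B ↪ Fin p) :=
  Function.Embedding.nonempty_of_card_le (by simpa using h)

lemma one_add_div_pow_le_exp {E B : ℝ} (m : ℕ) (hB : 0 < B) (hE : 0 < E) (hB1 : 1 ≤ B) :
    (1 + (E - 1) / B) ^ m ≤ Real.exp (m * E / B) := by
  have h0 : 0 ≤ 1 + (E - 1) / B := by
    rw [show 1 + (E - 1) / B = (B - 1 + E) / B by field_simp; ring]
    exact div_nonneg (by linarith) hB.le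
  have h1 : 1 + (E - 1) / B ≤ Real.exp (E / B) := by
    have h2 : (E - 1) / B ≤ E / B := by gcongr; linarith
    linarith [Real.add_one_le_exp (E / B)]
  refine (pow_le_pow_left₀ h0 h1 m).trans_eq ?_
  rw [← Real.exp_nat_mul, mul_div_assoc]

lemma exists_forall_mul_rpow_le {a b y : ℝ} (hy : y < 0) (hb : 0 < b) :
    ∃ p₀ : ℕ, 1 ≤ p₀ ∧ ∀ p : ℕ, p₀ ≤ p → a * (p : ℝ) ^ y ≤ b := by
  have h := ((tendsto_rpow_neg_atTop (neg_pos.2 hy)).comp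
    tendsto_natCast_atTop_atTop).const_mul a
  rw [mul_zero] at h
  obtain ⟨N, hN⟩ := Filter.eventually_atTop.1 (h.eventually_le_const hb)
  refine ⟨max N 1, le_max_right _ _, fun p hp => ?_⟩
  simpa using hN p ((le_max_left _ _).trans hp)

/-- Prior for large dimension: the block size is of order `p / m` with `m` of order `k`. -/
lemma le_expectedLength_of_large {M₁ M₂ α c γ ζ₀ η t : ℝ} (hc : 0 < c) (hη : 0 < η)
    (hcη : c * η ≤ 1 / 2) (ht : 0 < t) (ht1 : t ≤ 1) (hαt : 2 * α + t ≤ 1)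
    {n p k k₁ : ℕ} (hn : 1 ≤ n) (hp : 2 ≤ p)
    (hpη : 2 * c ^ 2 * (p : ℝ) ^ (2 * γ + 2 * η - 1) ≤ Real.log (1 + t ^ 2))
    (hk : (k : ℝ) ≤ c * min ((p : ℝ) ^ γ) ((n : ℝ) / Real.log (p : ℝ)))
    (hζ₀ : 0 < ζ₀) (hk₁ : (k₁ : ℝ) ≤ (1 - ζ₀) * (k : ℝ) - 1)
    {β : Fin p → ℝ} {σ : ℝ} (hθ : (⟨β, 1, σ⟩ : Param p) ∈ Theta M₁ M₂ p k₁)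
    {CI : Interval n p}
    (hCI : CI ∈ confidenceIntervals n α (Theta M₁ M₂ p k) fun b => ∑ i, b i) :
    ENNReal.ofReal ((1 - 2 * α - t) * ((ζ₀ * k) * (σ * Real.sqrt (η * (Real.log p / n))))) ≤
      expectedLength (⟨β, 1, σ⟩ : Param p) CI := by
  have hσ : 0 < σ := hθ.2.2.1
  have hn' : (0 : ℝ) < n := by exact_mod_cast hn
  have hp' : (2 : ℝ) ≤ p := by exact_mod_cast hp
  have hp0 : (0 : ℝ) < p := by linarith
  have hlog : 0 < Real.log p := Real.log_pos (by linarith)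
  have hk0 : (0 : ℝ) ≤ k := Nat.cast_nonneg k
  have hζk : 0 ≤ ζ₀ * k := by positivity
  have hk₁k : k₁ < k := by
    have : (k₁ : ℝ) < k := by nlinarith
    exact_mod_cast this
  -- The whole spare sparsity budget, at least `ζ₀ k`. The `-1` in `hk₁` makes it positive and
  -- excludes `k = 0`.
  set m := k - k₁ with hm
  have hmR : (m : ℝ) = k - k₁ := by rw [hm, Nat.cast_sub hk₁k.le]
  have hm1 : 1 ≤ m := by omega
  have hm1R : (1 : ℝ) ≤ m := by exact_mod_cast hm1
  have hmk : (m : ℝ) ≤ k := by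
    have : (0 : ℝ) ≤ k₁ := Nat.cast_nonneg k₁
    linarith
  have hζm : ζ₀ * k ≤ m := by rw [hmR]; linarith
  have hkγ : (m : ℝ) ≤ c * (p : ℝ) ^ γ :=
    hmk.trans (hk.trans (mul_le_mul_of_nonneg_left (min_le_left _ _) hc.le))
  have hkn : (k : ℝ) ≤ c * (n / Real.log p) :=
    hk.trans (mul_le_mul_of_nonneg_left (min_le_right _ _) hc.le)
  have hm2 : 2 * (m : ℝ) ^ 2 * (p : ℝ) ^ (2 * η) / p ≤ Real.log (1 + t ^ 2) := by
    refine le_trans ?_ hpη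
    have h1 : (m : ℝ) ^ 2 ≤ c ^ 2 * (p : ℝ) ^ (2 * γ) := by
      refine (pow_le_pow_left₀ (by linarith) hkγ 2).trans_eq ?_
      rw [mul_pow, ← Real.rpow_natCast ((p : ℝ) ^ γ), ← Real.rpow_mul hp0.le]
      congr 2
      push_cast
      ring
    rw [Real.rpow_sub hp0, Real.rpow_add hp0, Real.rpow_one, mul_div_assoc']
    gcongr ?_ / _
    have : 0 ≤ (p : ℝ) ^ (2 * η) := by positivity
    nlinarith
  -- `2m² p^{2η} ≤ p` follows from `log(1 + t²) ≤ t² ≤ 1`, so the blocks are nonempty.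
  have hmp : m ≤ p := by
    have h1 : Real.log (1 + t ^ 2) ≤ 1 := by
      have := Real.log_le_sub_one_of_pos (show 0 < 1 + t ^ 2 by positivity)
      nlinarith
    have h2 : (1 : ℝ) ≤ (p : ℝ) ^ (2 * η) := Real.one_le_rpow (by linarith) (by linarith)
    have h3 := hm2.trans h1
    rw [div_le_one hp0] at h3
    have : (m : ℝ) ≤ p := by nlinarith
    exact_mod_cast this
  set B := p / m with hB
  have hB1 : 1 ≤ B := (Nat.one_le_div_iff hm1).2 hmp
  have hB1R : (1 : ℝ) ≤ B := by exact_mod_cast hB1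
  -- Rounding `p/m` down costs at most a factor 2, the source of the 2 in `hpη`.
  have hpB : (p : ℝ) ≤ 2 * (m * B) := by
    have h1 : p < m * (B + 1) := by
      have h2 := Nat.div_add_mod p m
      have h3 := Nat.mod_lt p hm1
      rw [← hB] at h2
      rw [mul_add, mul_one]
      omega
    have h2 : m ≤ m * B := Nat.le_mul_of_pos_right m hB1
    have : p ≤ 2 * (m * B) := by rw [mul_add, mul_one] at h1; omega
    exact_mod_cast this
  obtain ⟨e⟩ := exists_block_embedding (Nat.mul_div_le p m)
  set r := η * (Real.log p / n) with hr
  have hr0 : 0 ≤ r := by positivity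
  -- Here `k ≤ c n / log p` is used: it cancels the `log p / n` in `r`.
  have hmr : m * r ≤ 1 / 2 := by
    calc m * r ≤ (c * (n / Real.log p)) * r := by gcongr; exact hmk.trans hkn
      _ = c * η := by rw [hr]; field_simp
      _ ≤ 1 / 2 := hcη
  have hchi : (1 + (Real.exp (2 * n * r) - 1) / B) ^ m ≤ 1 + t ^ 2 := by
    refine (one_add_div_pow_le_exp m (by linarith) (Real.exp_pos _) hB1R).trans ?_
    rw [← Real.le_log_iff_exp_le (by positivity)]
    refine le_trans ?_ hm2
    have hE : Real.exp (2 * n * r) = (p : ℝ) ^ (2 * η) := by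
      rw [Real.rpow_def_of_pos hp0, hr]
      congr 1
      field_simp
    rw [hE, div_le_div_iff₀ (by linarith) hp0]
    have : 0 ≤ m * (p : ℝ) ^ (2 * η) := by positivity
    nlinarith
  refine le_trans (ENNReal.ofReal_le_ofReal ?_)
    (le_expectedLength_of_blockSpike hB1 e (by omega) hθ hr0 hmr ht hchi hCI)
  have : 0 ≤ 1 - 2 * α - t := by linarith
  gcongr

/-- Prior for bounded dimension: a single perturbed coordinate of order `1 / √n`. -/
lemma le_expectedLength_of_small {M₁ M₂ α τ t : ℝ} (hτ : 0 < τ)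
    (hτ1 : τ ≤ 1 / 2) (ht : 0 < t) (hτt : Real.exp (2 * τ) ≤ 1 + t ^ 2)
    {n p k k₁ : ℕ} (hn : 1 ≤ n) (hp : 1 ≤ p) (hk : k₁ + 1 ≤ k)
    {β : Fin p → ℝ} {σ : ℝ} (hθ : (⟨β, 1, σ⟩ : Param p) ∈ Theta M₁ M₂ p k₁)
    {CI : Interval n p}
    (hCI : CI ∈ confidenceIntervals n α (Theta M₁ M₂ p k) fun b => ∑ i, b i) :
    ENNReal.ofReal ((1 - 2 * α - t) * (σ * Real.sqrt (τ / n))) ≤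
      expectedLength (⟨β, 1, σ⟩ : Param p) CI := by
  -- With `m = B = 1` the mixture is a single alternative, and the second-moment bound is `e^{2τ}`.
  have hn' : (1 : ℝ) ≤ n := by exact_mod_cast hn
  obtain ⟨e⟩ := exists_block_embedding (m := 1) (B := 1) (p := p) (by omega)
  have h := le_expectedLength_of_blockSpike le_rfl e hk hθ (r := τ / n) (t := t) (by positivity)
    (by
      rw [Nat.cast_one, one_mul]
      exact (div_le_self hτ.le hn').trans hτ1) ht
    (by
      rw [show 2 * (n : ℝ) * (τ / n) = 2 * τ by field_simp]
      simpa using hτt) hCI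
  simpa using h

end SparseCI

/-! ### Constants and the split between large and bounded `p` -/

theorem corollary2 (M₁ M₂ α c γ ζ₀ : ℝ) (hM₁ : 1 < M₁) (hM₂ : 0 < M₂)
    (hα₀ : 0 < α) (hα : α < 1 / 2) (hc : 0 < c) (hγ₀ : 0 ≤ γ) (hγ : γ < 1 / 2)
    (hζ₀ : 0 < ζ₀) (hζ₁ : ζ₀ < 1) :
    ∃ c₁ : ℝ, 0 < c₁ ∧ ∀ n p k k₁ : ℕ, 1 ≤ n → 2 ≤ p →
      (k : ℝ) ≤ c * min ((p : ℝ) ^ γ) ((n : ℝ) / Real.log (p : ℝ)) →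
      (k₁ : ℝ) ≤ (1 - ζ₀) * (k : ℝ) - 1 →
      ∀ (β : Fin p → ℝ) (σ : ℝ),
        (⟨β, 1, σ⟩ : SparseCI.Param p) ∈ SparseCI.Theta M₁ M₂ p k₁ →
        ENNReal.ofReal (c₁ * (k : ℝ) * Real.sqrt (Real.log (p : ℝ) / (n : ℝ)) * σ) ≤
          ⨅ CI ∈ SparseCI.confidenceIntervals n α (SparseCI.Theta M₁ M₂ p k)
              (fun b => ∑ i, b i),
            SparseCI.expectedLength (⟨β, 1, σ⟩ : SparseCI.Param p) CI := by
  -- Half the slack `1 - 2α`, so that `1 - 2α - t = t`.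
  set t := (1 - 2 * α) / 2 with ht_def
  have ht : 0 < t := by linarith
  have ht1 : t ≤ 1 := by linarith
  have hαt : 2 * α + t ≤ 1 := by linarith
  have hlt : 1 - 2 * α - t = t := by rw [ht_def]; ring
  have hlogt : 0 < Real.log (1 + t ^ 2) := Real.log_pos (by nlinarith)
  -- The first bound gives `2γ + 2η - 1 ≤ γ - 1/2 < 0`; the second gives `cη ≤ 1/2`.
  set η := min ((1 - 2 * γ) / 4) (1 / (2 * c)) with hη_def
  have hη : 0 < η := lt_min (by linarith) (by positivity)
  have hcη : c * η ≤ 1 / 2 := by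
    refine (mul_le_mul_of_nonneg_left (min_le_right _ _) hc.le).trans_eq ?_
    field_simp
  have hy : 2 * γ + 2 * η - 1 < 0 := by
    have : η ≤ (1 - 2 * γ) / 4 := min_le_left _ _
    linarith
  obtain ⟨p₀, hp₀, hlarge⟩ := SparseCI.exists_forall_mul_rpow_le (a := 2 * c ^ 2) hy hlogt
  set τ := min (1 / 2) (Real.log (1 + t ^ 2) / 2) with hτ_def
  have hτ : 0 < τ := lt_min (by norm_num) (by positivity)
  have hτt : Real.exp (2 * τ) ≤ 1 + t ^ 2 := by
    rw [← Real.le_log_iff_exp_le (by positivity)]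
    have : τ ≤ Real.log (1 + t ^ 2) / 2 := min_le_right _ _
    linarith
  have hp₀R : (1 : ℝ) ≤ p₀ := by exact_mod_cast hp₀
  -- The second entry serves `p ≤ p₀`, where `k ≤ c p^γ ≤ c p₀` and `√(log p) ≤ p₀`.
  refine ⟨min (t * ζ₀ * Real.sqrt η) (t * Real.sqrt τ / (c * p₀ * p₀)),
    lt_min (by positivity) (by positivity), ?_⟩
  intro n p k k₁ hn hp hk hk₁ β σ hθ
  refine le_iInf₂ fun CI hCI => ?_
  have hσ : 0 < σ := hθ.2.2.1
  have hn' : (0 : ℝ) < n := by exact_mod_cast hn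
  have hp1 : (1 : ℝ) ≤ p := by exact_mod_cast (by omega : 1 ≤ p)
  rcases le_total p₀ p with hpp | hpp
  · refine le_trans (ENNReal.ofReal_le_ofReal ?_) (SparseCI.le_expectedLength_of_large hc hη hcη ht
      ht1 hαt hn hp (hlarge p hpp) hk hζ₀ hk₁ hθ hCI)
    rw [hlt, Real.sqrt_mul hη.le]
    calc _ ≤ t * ζ₀ * Real.sqrt η * k * Real.sqrt (Real.log p / n) * σ := by
          gcongr
          exact min_le_left _ _
      _ = _ := by ring
  · have hkk : k₁ + 1 ≤ k := by
      have : (k₁ : ℝ) + 1 ≤ k := by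
        have : 0 ≤ ζ₀ * (k : ℝ) := by positivity
        linarith
      exact_mod_cast this
    refine le_trans (ENNReal.ofReal_le_ofReal ?_) (SparseCI.le_expectedLength_of_small hτ
      (min_le_left _ _) ht hτt hn (by omega) hkk hθ hCI)
    rw [hlt, Real.sqrt_div hτ.le, Real.sqrt_div (Real.log_nonneg hp1)]
    have hppR : (p : ℝ) ≤ p₀ := by exact_mod_cast hpp
    have hk' : (k : ℝ) ≤ c * p₀ := by
      refine hk.trans (mul_le_mul_of_nonneg_left ((min_le_left _ _).trans ?_) hc.le)
      refine le_trans ?_ hppR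
      simpa using Real.rpow_le_rpow_of_exponent_le hp1 (show γ ≤ 1 by linarith)
    have hlog : Real.sqrt (Real.log p) ≤ p₀ := by
      rw [Real.sqrt_le_left (by linarith)]
      have := Real.log_le_sub_one_of_pos (show (0 : ℝ) < p by linarith)
      nlinarith
    calc _ ≤ t * Real.sqrt τ / (c * p₀ * p₀) * (c * p₀) * (p₀ / Real.sqrt n) * σ := by
          gcongr
          exact min_le_right _ _
      _ = _ := by field_simp
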